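/- Let $d\ge 1$, $\nu>-\tfrac12$, $\alpha,\phi>0$, $k>1$ and $c_f>0$. Let $f:\mathbb R\to[0,\infty)$ be integrable with $f(\omega)\sim c_f|\omega|^{-k}$ as $|\omega|\to\infty$, and put $$g(\lambda,\omega)=\phi\Big(\alpha^2 f(\omega)^{-1/(\nu+1/2)}+\|\lambda\|^2\Big)^{-(\nu+(d+1)/2)},\qquad \lambda\in\mathbb R^d,\ \omega\in\mathbb R,$$ with $g(\lambda,\omega)=0$ where $f(\omega)=0$. Let $Z(s,t)$, $s\in\mathbb R^d$, $t\in\mathbb R$, be a real Gaussian process with constant mean and stationary covariance $\operatorname{Cov}(Z(s,t),Z(s',t'))=K_f(s-s',t-t')$, where $$K_f(s,t)=\int_{\mathbb R}\int_{\mathbb R^d} g(\lambda,\omega)\,e^{i s^T\lambda+i t\omega}\,d\lambda\,d\omega .$$ A process $X$ with finite second moments has mean-square derivative $Y$ in direction $u$ if, at every point $x$, $(X(x+hu)-X(x))/h\to Y(x)$ in $L^2$ as $h\to0$; it is $m$ times mean-square differentiable with respect to a set of directions if all iterated (including mixed) mean-square derivatives in these directions up to order $m$ exist. Then for every integer $m\ge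 0$: 1. $Z$ is $m$ times mean-square differentiable in time if $(k-1)/2>m$. 2. $Z$ is $m$ times mean-square differentiable in space (with respect to the set of all spatial directions) if and only if $(\nu+\tfrac12)(k-1)/k>m$; and for every single spatial direction $v\ne0$, $Z$ is $m$ times mean-square differentiable along $v$ if and only if the same inequality holds. -/

import Mathlib

open MeasureTheory ProbabilityTheory Filter Topology Asymptotics

noncomputable section

namespace HalfSpectral

/-- Space-time points `(s, t)`, with `s ∈ ℝ^d` and `t ∈ ℝ`. -/
abbrev SpaceTime (d : ℕ) : Type := EuclideanSpace ℝ (Fin d) × ℝ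

/-- The spectral density
`g(λ, ω) = φ (α² f(ω)^(-1/(ν + 1/2)) + ‖λ‖²)^(-(ν + (d+1)/2))`.
Where `f ω = 0` the base is `∞`, so `g` is `0` there. -/
def spectralDensity (d : ℕ) (ν α φ : ℝ) (f : ℝ → ℝ)
    (l : EuclideanSpace ℝ (Fin d)) (ω : ℝ) : ℝ :=
  if f ω = 0 then 0
  else φ * (α ^ 2 * f ω ^ (-1 / (ν + 1 / 2)) + ‖l‖ ^ 2) ^ (-(ν + ((d : ℝ) + 1) / 2))

/-- The stationary covariance function `K_f(s, t) = ∫ ∫ g(λ, ω) exp(i sᵀλ + i t ω) dλ dω`. -/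
def covK (d : ℕ) (ν α φ : ℝ) (f : ℝ → ℝ) (p : SpaceTime d) : ℂ :=
  ∫ ω : ℝ, ∫ l : EuclideanSpace ℝ (Fin d),
    (spectralDensity d ν α φ f l ω : ℂ) *
      Complex.exp (Complex.I * ((inner ℝ p.1 l : ℝ) : ℂ) + Complex.I * ((p.2 * ω : ℝ) : ℂ))

variable {Ω E : Type*} [MeasurableSpace Ω] [AddCommGroup E] [Module ℝ E]

/-- `Y` is the mean-square derivative of the process `X` in the direction `u`: at every point `x`,
`(X (x + h u) - X x) / h → Y x` in `L²(P)` as `h → 0`. -/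
def HasMSDerivAlong (P : Measure Ω) (u : E) (X Y : E → Ω → ℝ) : Prop :=
  ∀ x : E, Tendsto
    (fun h : ℝ => eLpNorm (fun w => h⁻¹ * (X (x + h • u) w - X x w) - Y x w) 2 P)
    (𝓝[≠] 0) (𝓝 0)

/-- The process `X` is `m` times mean-square differentiable in the directions of `D`: it has
finite second moments, and all iterated mean-square derivatives of order at most `m` in directions
from `D` (mixed ones included) exist at every point. -/
def MSDifferentiable (P : Measure Ω) (D : Set E) : ℕ → (E → Ω → ℝ) → Prop
  | 0, X => ∀ x, MemLp (X x) 2 P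
  | m + 1, X => (∀ x, MemLp (X x) 2 P) ∧
      ∀ u ∈ D, ∃ Y : E → Ω → ℝ, HasMSDerivAlong P u X Y ∧ MSDifferentiable P D m Y

/-- The time direction. -/
def timeDir (d : ℕ) : Set (SpaceTime d) := {(0, 1)}

/-- All spatial directions. -/
def spaceDirs (d : ℕ) : Set (SpaceTime d) :=
  Set.range fun v : EuclideanSpace ℝ (Fin d) => ((v, 0) : SpaceTime d)

end HalfSpectral

end

/-! In L², difference quotients of Z are governed by the Gram kernel E[Z(p)Z(q)], which is the
cosine transform of the measure with density g plus an atom at frequency 0 carrying the mean. A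
mean-square derivative along u exists exactly when the squared phase of u is integrable, and its
Gram kernel is then the transform of the measure reweighted by that square
(`exists_tendsto_diffQuot`, `integrable_sq_phase`, `of_tendsto_diffQuot`). By induction, m-fold
differentiability becomes finiteness of spectral moments of order up to 2m.

The moments come from scaling: putting λ = √b y with b = α² f(ω)^(-1/(ν+1/2)), the λ-integral of g
against a function homogeneous of degree 2m is a constant times f(ω)^(1-m/(ν+1/2))
(`lintegral_spectralMeasure`). Time moments reduce to ∫ ω^(2m) f, finite if k - 2m > 1; spatial ones
to ∫ f^(1-m/(ν+1/2)), finite iff k(1 - m/(ν+1/2)) > 1. -/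

namespace HalfSpectral

/-! ### Products of difference quotients of characters. -/

section Trig

/-- Real part of the product of the difference quotients at step `h` and `h'` of
`r ↦ exp (i r t)` and `r ↦ exp (-i r t)`, rotated by the phase `θ`. -/
noncomputable def quotientProduct (θ t h h' : ℝ) : ℝ :=
  h⁻¹ * h'⁻¹ * (Real.cos (θ + (h - h') * t) - Real.cos (θ + h * t) - Real.cos (θ - h' * t)
    + Real.cos θ)

/-- Splits the product into one-variable quotients, each bounded by |t| and convergent, so that
domination and joint limit can both be read off. -/
theorem quotientProduct_eq (θ t h h' : ℝ) :
    quotientProduct θ t h h' =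
      Real.cos θ * ((h⁻¹ * (Real.cos (h * t) - 1)) * (h'⁻¹ * (Real.cos (h' * t) - 1))
        + (h⁻¹ * Real.sin (h * t)) * (h'⁻¹ * Real.sin (h' * t)))
      - Real.sin θ * ((h⁻¹ * Real.sin (h * t)) * (h'⁻¹ * (Real.cos (h' * t) - 1))
        - (h⁻¹ * (Real.cos (h * t) - 1)) * (h'⁻¹ * Real.sin (h' * t))) := by
  have e : θ + (h - h') * t = θ + (h * t - h' * t) := by ring
  rw [quotientProduct, e]
  simp only [Real.cos_add, Real.cos_sub, Real.sin_sub]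
  ring

theorem abs_cos_sub_one_le (x : ℝ) : |Real.cos x - 1| ≤ |x| := by
  have e : Real.cos x - 1 = -(2 * Real.sin (x / 2) * Real.sin (x / 2)) := by
    have h := Real.cos_two_mul (x / 2)
    rw [show 2 * (x / 2) = x by ring] at h
    have := Real.sin_sq_add_cos_sq (x / 2)
    linarith
  have h1 : |Real.sin (x / 2)| ≤ |x| / 2 := by
    simpa [abs_div] using Real.abs_sin_le_abs (x := x / 2)
  have h2 := Real.abs_sin_le_one (x / 2)
  rw [e, abs_neg, abs_mul, abs_mul, abs_two]
  nlinarith [abs_nonneg (Real.sin (x / 2)), abs_nonneg x]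

theorem abs_inv_mul_le {h y t : ℝ} (hy : |y| ≤ |h * t|) : |h⁻¹ * y| ≤ |t| := by
  rcases eq_or_ne h 0 with rfl | h0
  -- At h = 0 the convention 0⁻¹ = 0 keeps the bound true, so domination needs no restriction on h.
  · simp
  · rw [abs_mul, abs_inv, inv_mul_le_iff₀ (abs_pos.2 h0), ← abs_mul]
    exact hy

theorem abs_quotientProduct_le (θ t h h' : ℝ) : |quotientProduct θ t h h'| ≤ 4 * t ^ 2 := by
  rw [quotientProduct_eq]
  have a := abs_inv_mul_le (abs_cos_sub_one_le (h * t))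
  have a' := abs_inv_mul_le (abs_cos_sub_one_le (h' * t))
  have b := abs_inv_mul_le (Real.abs_sin_le_abs (x := h * t))
  have b' := abs_inv_mul_le (Real.abs_sin_le_abs (x := h' * t))
  generalize h⁻¹ * (Real.cos (h * t) - 1) = p at *
  generalize h'⁻¹ * (Real.cos (h' * t) - 1) = p' at *
  generalize h⁻¹ * Real.sin (h * t) = q at *
  generalize h'⁻¹ * Real.sin (h' * t) = q' at *
  have key : ∀ x y : ℝ, |x| ≤ |t| → |y| ≤ |t| → |x * y| ≤ t ^ 2 := fun x y hx hy => by
    rw [abs_mul, ← sq_abs t, sq]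
    exact mul_le_mul hx hy (abs_nonneg _) (abs_nonneg _)
  have hA : |p * p' + q * q'| ≤ 2 * t ^ 2 := by
    linarith [abs_add_le (p * p') (q * q'), key p p' a a', key q q' b b']
  have hB : |q * p' - p * q'| ≤ 2 * t ^ 2 := by
    linarith [abs_sub (q * p') (p * q'), key q p' b a', key p q' a b']
  have hA' : |Real.cos θ * (p * p' + q * q')| ≤ 2 * t ^ 2 := by
    rw [abs_mul]
    exact (mul_le_of_le_one_left (abs_nonneg _) (Real.abs_cos_le_one θ)).trans hA
  have hB' : |Real.sin θ * (q * p' - p * q')| ≤ 2 * t ^ 2 := by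
    rw [abs_mul]
    exact (mul_le_of_le_one_left (abs_nonneg _) (Real.abs_sin_le_one θ)).trans hB
  linarith [abs_sub (Real.cos θ * (p * p' + q * q')) (Real.sin θ * (q * p' - p * q'))]

theorem tendsto_inv_mul_sin (t : ℝ) :
    Tendsto (fun h : ℝ => h⁻¹ * Real.sin (h * t)) (𝓝[≠] 0) (𝓝 t) := by
  have h : HasDerivAt (fun h : ℝ => Real.sin (h * t)) t 0 := by
    simpa using ((hasDerivAt_id (0 : ℝ)).mul_const t).sin
  simpa using h.tendsto_slope_zero

theorem tendsto_inv_mul_cos_sub_one (t : ℝ) :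
    Tendsto (fun h : ℝ => h⁻¹ * (Real.cos (h * t) - 1)) (𝓝[≠] 0) (𝓝 0) := by
  have h : HasDerivAt (fun h : ℝ => Real.cos (h * t)) 0 0 := by
    simpa using ((hasDerivAt_id (0 : ℝ)).mul_const t).cos
  simpa using h.tendsto_slope_zero

theorem tendsto_quotientProduct (θ t : ℝ) :
    Tendsto (fun z : ℝ × ℝ => quotientProduct θ t z.1 z.2) (𝓝[≠] 0 ×ˢ 𝓝[≠] 0)
      (𝓝 (Real.cos θ * t ^ 2)) := by
  simp only [quotientProduct_eq]
  have p := (tendsto_inv_mul_cos_sub_one t).comp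
    (tendsto_fst (f := 𝓝[≠] (0 : ℝ)) (g := 𝓝[≠] (0 : ℝ)))
  have p' := (tendsto_inv_mul_cos_sub_one t).comp
    (tendsto_snd (f := 𝓝[≠] (0 : ℝ)) (g := 𝓝[≠] (0 : ℝ)))
  have q := (tendsto_inv_mul_sin t).comp
    (tendsto_fst (f := 𝓝[≠] (0 : ℝ)) (g := 𝓝[≠] (0 : ℝ)))
  have q' := (tendsto_inv_mul_sin t).comp
    (tendsto_snd (f := 𝓝[≠] (0 : ℝ)) (g := 𝓝[≠] (0 : ℝ)))
  have := (((p.mul p').add (q.mul q')).const_mul (Real.cos θ)).sub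
    (((q.mul p').sub (p.mul q')).const_mul (Real.sin θ))
  have e : Real.cos θ * t ^ 2 =
      Real.cos θ * (0 * 0 + t * t) - Real.sin θ * (t * 0 - 0 * t) := by ring
  rw [e]
  exact this

end Trig

/-! ### Differentiation of a Hilbert-space family through its spectral measure. -/

section Hilbert

variable {E F H : Type*} [AddCommGroup E] [Module ℝ E] [MeasurableSpace F]
  [NormedAddCommGroup H] [InnerProductSpace ℝ H]

/-- The Gram kernel of the family `X` is the cosine transform of the measure `ρ`, where `ph x ξ`
is the phase of the frequency `ξ` at the point `x`. -/
def HasSpectralMeasure (ph : E →ₗ[ℝ] F → ℝ) (ρ : Measure F) (X : E → H) : Prop :=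
  ∀ x y, inner ℝ (X x) (X y) = ∫ ξ, Real.cos (ph (x - y) ξ) ∂ρ

/-- The difference quotient of `X` at `x` in the direction `u` with step `h`. -/
noncomputable def diffQuot (X : E → H) (u x : E) (h : ℝ) : H := h⁻¹ • (X (x + h • u) - X x)

variable {ph : E →ₗ[ℝ] F → ℝ} {ρ : Measure F} [IsFiniteMeasure ρ] {X : E → H}

theorem integrable_cos_phase (hph : ∀ x, Measurable (ph x)) (x : E) :
    Integrable (fun ξ => Real.cos (ph x ξ)) ρ :=
  Integrable.of_bound (Real.measurable_cos.comp (hph x)).aestronglyMeasurable 1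
    (Eventually.of_forall fun _ => Real.abs_cos_le_one _)

theorem HasSpectralMeasure.inner_diffQuot (hX : HasSpectralMeasure ph ρ X)
    (hph : ∀ x, Measurable (ph x)) (u x y : E) (h h' : ℝ) :
    inner ℝ (diffQuot X u x h) (diffQuot X u y h') =
      ∫ ξ, quotientProduct (ph (x - y) ξ) (ph u ξ) h h' ∂ρ := by
  have e1 : x + h • u - (y + h' • u) = x - y + (h - h') • u := by rw [sub_smul]; abel
  have e2 : x + h • u - y = x - y + h • u := by abel
  have e3 : x - (y + h' • u) = x - y - h' • u := by abel
  simp only [diffQuot, inner_smul_left, inner_smul_right, inner_sub_left, inner_sub_right, hX _ _,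
    e1, e2, e3]
  have I := integrable_cos_phase (ρ := ρ) hph
  have key : ∀ ξ, quotientProduct (ph (x - y) ξ) (ph u ξ) h h' =
      h⁻¹ * h'⁻¹ * (Real.cos (ph (x - y + (h - h') • u) ξ) - Real.cos (ph (x - y + h • u) ξ)
        - Real.cos (ph (x - y - h' • u) ξ) + Real.cos (ph (x - y) ξ)) := fun ξ => by
    simp only [quotientProduct, map_add, map_sub, map_smul, Pi.add_apply, Pi.sub_apply,
      Pi.smul_apply, smul_eq_mul]
  simp only [key]
  rw [integral_const_mul, integral_add, integral_sub, integral_sub]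
  · simp only [conj_trivial]
    ring
  · exact I _
  · exact I _
  · exact (I _).sub (I _)
  · exact I _
  · exact ((I _).sub (I _)).sub (I _)
  · exact I _

/-- Dominated convergence. The steps h, h' tend to 0 independently, as the Cauchy criterion
requires. -/
theorem HasSpectralMeasure.tendsto_inner_diffQuot (hX : HasSpectralMeasure ph ρ X)
    (hph : ∀ x, Measurable (ph x)) {u : E} (hu : Integrable (fun ξ => ph u ξ ^ 2) ρ) (x y : E) :
    Tendsto (fun z : ℝ × ℝ => inner ℝ (diffQuot X u x z.1) (diffQuot X u y z.2))
      (𝓝[≠] 0 ×ˢ 𝓝[≠] 0) (𝓝 (∫ ξ, Real.cos (ph (x - y) ξ) * ph u ξ ^ 2 ∂ρ)) := by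
  simp only [hX.inner_diffQuot hph]
  refine tendsto_integral_filter_of_dominated_convergence (fun ξ => 4 * ph u ξ ^ 2)
    (Eventually.of_forall fun z => ?_) (Eventually.of_forall fun z =>
      Eventually.of_forall fun ξ => abs_quotientProduct_le _ _ _ _) (hu.const_mul 4)
    (Eventually.of_forall fun ξ => tendsto_quotientProduct _ _)
  have h1 := hph u
  have h2 := hph (x - y)
  unfold quotientProduct
  exact Measurable.aestronglyMeasurable (by fun_prop)

theorem HasSpectralMeasure.exists_tendsto_diffQuot [CompleteSpace H]
    (hX : HasSpectralMeasure ph ρ X) (hph : ∀ x, Measurable (ph x)) {u : E}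
    (hu : Integrable (fun ξ => ph u ξ ^ 2) ρ) (x : E) :
    ∃ y, Tendsto (diffQuot X u x) (𝓝[≠] 0) (𝓝 y) := by
  refine cauchy_map_iff_exists_tendsto.1 (cauchy_map_iff.2 ⟨inferInstance, ?_⟩)
  rw [Metric.uniformity_eq_comap_nhds_zero, tendsto_comap_iff]
  have h := hX.tendsto_inner_diffQuot hph hu x x
  have h1 := h.comp (tendsto_fst.prodMk tendsto_fst : Tendsto (fun z : ℝ × ℝ => (z.1, z.1))
    (𝓝[≠] 0 ×ˢ 𝓝[≠] 0) _)
  have h2 := h.comp (tendsto_snd.prodMk tendsto_snd : Tendsto (fun z : ℝ × ℝ => (z.2, z.2))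
    (𝓝[≠] 0 ×ˢ 𝓝[≠] 0) _)
  -- Expanding ‖a - b‖² gives three inner products with the same limit L, and L - 2L + L = 0: the
  -- quotients are Cauchy.
  have h3 := (((h1.sub (h.const_mul 2)).add h2).sqrt)
  convert h3 using 2
  · simp only [Function.comp, dist_eq_norm]
    rw [← Real.sqrt_sq (norm_nonneg _), norm_sub_sq_real, real_inner_self_eq_norm_sq,
      real_inner_self_eq_norm_sq]
  · rw [eq_comm, Real.sqrt_eq_zero']
    linarith

/-- The derivative is again a family of the same kind, which is what lets the differentiability
order be handled by induction. -/
theorem HasSpectralMeasure.of_tendsto_diffQuot (hX : HasSpectralMeasure ph ρ X)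
    (hph : ∀ x, Measurable (ph x)) {u : E} (hu : Integrable (fun ξ => ph u ξ ^ 2) ρ) {Y : E → H}
    (hY : ∀ x, Tendsto (diffQuot X u x) (𝓝[≠] 0) (𝓝 (Y x))) :
    HasSpectralMeasure ph (ρ.withDensity fun ξ => ENNReal.ofReal (ph u ξ ^ 2)) Y := by
  intro x y
  have h1 := ((hY x).comp tendsto_fst).inner (𝕜 := ℝ) ((hY y).comp tendsto_snd)
  rw [tendsto_nhds_unique h1 (hX.tendsto_inner_diffQuot hph hu x y),
    integral_withDensity_eq_integral_toReal_smul ((hph u).pow_const 2).ennreal_ofReal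
      (Eventually.of_forall fun _ => ENNReal.ofReal_lt_top)]
  refine integral_congr_ae (Eventually.of_forall fun ξ => ?_)
  simp only [ENNReal.toReal_ofReal (sq_nonneg _), smul_eq_mul]
  ring

/-- Fatou: on the diagonal h = h' the quotient product is nonnegative and tends to the squared
phase, while its integrals ‖`diffQuot`‖² converge to ‖y‖². -/
theorem HasSpectralMeasure.integrable_sq_phase (hX : HasSpectralMeasure ph ρ X)
    (hph : ∀ x, Measurable (ph x)) {u x y} (hY : Tendsto (diffQuot X u x) (𝓝[≠] 0) (𝓝 y)) :
    Integrable (fun ξ => ph u ξ ^ 2) ρ := by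
  have hq : ∀ ξ h, quotientProduct (ph (x - x) ξ) (ph u ξ) h h =
      (h⁻¹ * (Real.cos (h * ph u ξ) - 1)) ^ 2 + (h⁻¹ * Real.sin (h * ph u ξ)) ^ 2 := fun ξ h => by
    rw [quotientProduct_eq]; simp; ring
  have hnonneg : ∀ ξ h, 0 ≤ quotientProduct (ph (x - x) ξ) (ph u ξ) h h := fun ξ h => by
    rw [hq]; positivity
  have h1 := hph u
  have h2 := hph (x - x)
  have hmeas : ∀ h, Measurable fun ξ => quotientProduct (ph (x - x) ξ) (ph u ξ) h h := fun h => by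
    unfold quotientProduct; fun_prop
  have hint : ∀ h, Integrable (fun ξ => quotientProduct (ph (x - x) ξ) (ph u ξ) h h) ρ :=
    fun h => by
    -- Four cosines give a bound depending on h; the uniform bound 4t² would presuppose the
    -- integrability being proved.
    refine Integrable.of_bound (hmeas h).aestronglyMeasurable (|h⁻¹ * h⁻¹| * 4)
      (Eventually.of_forall fun ξ => ?_)
    rw [quotientProduct, Real.norm_eq_abs, abs_mul]
    refine mul_le_mul_of_nonneg_left ?_ (abs_nonneg _)
    have b1 := abs_le.1 (Real.abs_cos_le_one (ph (x - x) ξ + (h - h) * ph u ξ))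
    have b2 := abs_le.1 (Real.abs_cos_le_one (ph (x - x) ξ + h * ph u ξ))
    have b3 := abs_le.1 (Real.abs_cos_le_one (ph (x - x) ξ - h * ph u ξ))
    have b4 := abs_le.1 (Real.abs_cos_le_one (ph (x - x) ξ))
    exact abs_le.2 ⟨by linarith, by linarith⟩
  refine ⟨(h1.pow_const 2).aestronglyMeasurable, ?_⟩
  have hlim : ∀ ξ, Tendsto (fun h => ENNReal.ofReal (quotientProduct (ph (x - x) ξ) (ph u ξ) h h))
      (𝓝[≠] 0) (𝓝 ‖ph u ξ ^ 2‖ₑ) := fun ξ => by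
    rw [Real.enorm_eq_ofReal (sq_nonneg _)]
    refine (ENNReal.continuous_ofReal.tendsto _).comp ?_
    have := (tendsto_quotientProduct (ph (x - x) ξ) (ph u ξ)).comp
      ((tendsto_id (x := 𝓝[≠] (0 : ℝ))).prodMk tendsto_id)
    simpa [Function.comp_def] using this
  have hnorm : Tendsto (fun h => ∫⁻ ξ, ENNReal.ofReal
      (quotientProduct (ph (x - x) ξ) (ph u ξ) h h) ∂ρ) (𝓝[≠] 0)
      (𝓝 (ENNReal.ofReal (inner ℝ y y))) := by
    refine ((ENNReal.continuous_ofReal.tendsto _).comp (hY.inner (𝕜 := ℝ) hY)).congr fun h => ?_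
    simp only [Function.comp]
    rw [hX.inner_diffQuot hph, ofReal_integral_eq_lintegral_ofReal (hint h)
      (Eventually.of_forall fun ξ => hnonneg ξ h)]
  calc ∫⁻ ξ, ‖ph u ξ ^ 2‖ₑ ∂ρ
      = ∫⁻ ξ, liminf (fun h => ENNReal.ofReal
          (quotientProduct (ph (x - x) ξ) (ph u ξ) h h)) (𝓝[≠] 0) ∂ρ := by
        simp only [fun ξ => (hlim ξ).liminf_eq]
    _ ≤ liminf (fun h => ∫⁻ ξ, ENNReal.ofReal
          (quotientProduct (ph (x - x) ξ) (ph u ξ) h h) ∂ρ) (𝓝[≠] 0) :=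
        lintegral_liminf_le fun h => (hmeas h).ennreal_ofReal
    _ = ENNReal.ofReal (inner ℝ y y) := hnorm.liminf_eq
    _ < ⊤ := ENNReal.ofReal_lt_top

end Hilbert

end HalfSpectral

namespace HalfSpectral

/-! ### From mean-square derivatives to spectral moments. -/

section MeanSquare

variable {Ω E F : Type*} [MeasurableSpace Ω] [AddCommGroup E] [Module ℝ E] [MeasurableSpace F]
  {P : Measure Ω}

theorem MSDifferentiable.memLp {D : Set E} {m : ℕ} {X : E → Ω → ℝ}
    (h : MSDifferentiable P D m X) (x : E) : MemLp (X x) 2 P := by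
  cases m with
  | zero => exact h x
  | succ m => exact h.1 x

theorem MSDifferentiable.mono {D D' : Set E} (hD : D' ⊆ D) {m : ℕ} {X : E → Ω → ℝ}
    (h : MSDifferentiable P D m X) : MSDifferentiable P D' m X := by
  induction m generalizing X with
  | zero => exact h
  | succ m ih =>
    refine ⟨h.1, fun u hu => ?_⟩
    obtain ⟨Y, hY, hY'⟩ := h.2 u (hD hu)
    exact ⟨Y, hY, ih hY'⟩

theorem hasMSDerivAlong_iff {X Y : E → Ω → ℝ} (hX : ∀ x, MemLp (X x) 2 P)
    (hY : ∀ x, MemLp (Y x) 2 P) (u : E) :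
    HasMSDerivAlong P u X Y ↔
      ∀ x, Tendsto (diffQuot (fun x => (hX x).toLp (X x)) u x) (𝓝[≠] 0)
        (𝓝 ((hY x).toLp (Y x))) :=
  forall_congr' fun x =>
    (Lp.tendsto_Lp_iff_tendsto_eLpNorm'' (fun (h : ℝ) => h⁻¹ • (X (x + h • u) - X x))
      (fun _ => ((hX _).sub (hX _)).const_smul _) (Y x) (hY x)).symm

theorem inner_toLp {X Y : Ω → ℝ} (hX : MemLp X 2 P) (hY : MemLp Y 2 P) :
    inner ℝ (hX.toLp X) (hY.toLp Y) = ∫ w, X w * Y w ∂P := by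
  rw [L2.inner_def]
  refine integral_congr_ae ?_
  filter_upwards [hX.coeFn_toLp, hY.coeFn_toLp] with w h1 h2
  rw [h1, h2]
  simp [mul_comm]

variable {ph : E →ₗ[ℝ] F → ℝ}

/-- A process whose spectral measure has finite moments of order up to `2 m`, with respect to a
weight dominating the squared phases of the directions in `D`, is `m` times mean-square
differentiable in these directions. -/
theorem msDifferentiable_of_lintegral_pow_ne_top (hph : ∀ x, Measurable (ph x)) {D : Set E}
    {W : F → ENNReal}
    (hW : ∀ u ∈ D, ∃ C : ENNReal, C ≠ ⊤ ∧ ∀ ξ, ENNReal.ofReal (ph u ξ ^ 2) ≤ C * W ξ) (m : ℕ)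
    {ρ : Measure F} (hρ : ∀ j ≤ m, ∫⁻ ξ, W ξ ^ j ∂ρ ≠ ⊤) {X : E → Ω → ℝ}
    (hX : ∀ x, MemLp (X x) 2 P)
    (hXρ : HasSpectralMeasure ph ρ fun x => (hX x).toLp (X x)) :
    MSDifferentiable P D m X := by
  induction m generalizing ρ X with
  | zero => exact hX
  | succ m ih =>
    refine ⟨hX, fun u hu => ?_⟩
    -- The moment of order j = 0 is the total mass.
    have : IsFiniteMeasure ρ := ⟨by simpa [lt_top_iff_ne_top] using hρ 0 (Nat.zero_le _)⟩
    obtain ⟨C, hC, hCW⟩ := hW u hu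
    have hbound : ∀ j, ∫⁻ ξ, ENNReal.ofReal (ph u ξ ^ 2) * W ξ ^ j ∂ρ ≤
        C * ∫⁻ ξ, W ξ ^ (j + 1) ∂ρ := fun j => by
      rw [← lintegral_const_mul' _ _ hC]
      refine lintegral_mono fun ξ => ?_
      rw [pow_succ' (W ξ), ← mul_assoc]
      gcongr
      exact hCW ξ
    have hint : Integrable (fun ξ => ph u ξ ^ 2) ρ := by
      refine ⟨((hph u).pow_const 2).aestronglyMeasurable, ?_⟩
      rw [hasFiniteIntegral_iff_ofReal (Eventually.of_forall fun _ => sq_nonneg _)]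
      refine lt_of_le_of_lt ?_ (ENNReal.mul_lt_top hC.lt_top (hρ 1 (by omega)).lt_top)
      simpa using hbound 0
    choose Y hY using fun x => hXρ.exists_tendsto_diffQuot hph hint x
    have hYL : ∀ x, MemLp (Y x) 2 P := fun x => Lp.memLp (Y x)
    have hYY : (fun x => (hYL x).toLp (Y x)) = Y := funext fun x => Lp.toLp_coeFn _ _
    refine ⟨fun x => Y x, (hasMSDerivAlong_iff hX hYL u).2 fun x => ?_, ?_⟩
    · rw [congrFun hYY x]
      exact hY x
    -- The new density costs one factor of W, so moment j of the derivative is controlled by moment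
    -- j + 1 of ρ.
    · refine ih (ρ := ρ.withDensity fun ξ => ENNReal.ofReal (ph u ξ ^ 2)) (fun j hj => ?_) hYL ?_
      · refine ((lintegral_withDensity_le_lintegral_mul _
          ((hph u).pow_const 2).ennreal_ofReal _).trans_lt ?_).ne
        exact (hbound j).trans_lt (ENNReal.mul_lt_top hC.lt_top (hρ (j + 1) (by omega)).lt_top)
      · rw [hYY]
        exact hXρ.of_tendsto_diffQuot hph hint hY

/-- The spectral measure of a process which is `m` times mean-square differentiable along `u` has
finite moments of order `2 m` in that direction. -/
theorem MSDifferentiable.lintegral_pow_ne_top (hph : ∀ x, Measurable (ph x)) {u : E} {m : ℕ}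
    {ρ : Measure F} [IsFiniteMeasure ρ] {X : E → Ω → ℝ} (h : MSDifferentiable P {u} m X)
    (hX : ∀ x, MemLp (X x) 2 P)
    (hXρ : HasSpectralMeasure ph ρ fun x => (hX x).toLp (X x)) :
    ∫⁻ ξ, ENNReal.ofReal (ph u ξ ^ 2) ^ m ∂ρ ≠ ⊤ := by
  induction m generalizing ρ X with
  | zero => simp
  | succ m ih =>
    obtain ⟨Y, hY, hY'⟩ := h.2 u rfl
    have hlim := (hasMSDerivAlong_iff hX hY'.memLp u).1 hY
    have hint := hXρ.integrable_sq_phase hph (hlim 0)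
    have hfin := (hasFiniteIntegral_iff_ofReal (Eventually.of_forall fun _ => sq_nonneg _)).1 hint.2
    have hmeas : Measurable fun ξ => ENNReal.ofReal (ph u ξ ^ 2) :=
      ((hph u).pow_const 2).ennreal_ofReal
    have := isFiniteMeasure_withDensity hfin.ne
    have := ih hY' hY'.memLp (hXρ.of_tendsto_diffQuot hph hint hlim)
    rw [lintegral_withDensity_eq_lintegral_mul _ hmeas (hmeas.pow_const m)] at this
    simpa [pow_succ'] using this

end MeanSquare

end HalfSpectral

namespace HalfSpectral

/-! ### Dilation of integrals on a Euclidean space. -/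

section Scaling

variable {V : Type*} [NormedAddCommGroup V] [InnerProductSpace ℝ V] [FiniteDimensional ℝ V]
  [MeasurableSpace V] [BorelSpace V]

theorem lintegral_comp_smul {r : ℝ} (hr : 0 < r) (G : V → ENNReal) :
    ENNReal.ofReal (r ^ Module.finrank ℝ V) * ∫⁻ y, G (r • y) = ∫⁻ y, G y := by
  have hmap : ∫⁻ y, G (r • y) = ∫⁻ y, G y ∂(Measure.map (r • ·) (volume : Measure V)) :=
    (lintegral_map_equiv (μ := (volume : Measure V)) G
      (Homeomorph.smulOfNeZero r hr.ne').toMeasurableEquiv).symm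
  have hpos : 0 < r ^ Module.finrank ℝ V := pow_pos hr _
  rw [hmap, Measure.map_addHaar_smul _ hr.ne', lintegral_smul_measure, smul_eq_mul, ← mul_assoc,
    ← ENNReal.ofReal_mul hpos.le, abs_of_pos (inv_pos.2 hpos), mul_inv_cancel₀ hpos.ne']
  simp

/-- Integrating a function homogeneous of degree `2 m` against `(b + ‖l‖ ^ 2) ^ (-q)` scales as a
power of `b`. -/
theorem lintegral_homogeneous_mul_rpow {H : V → ℝ} {m : ℕ}
    (hhom : ∀ r : ℝ, ∀ y, H (r • y) = r ^ (2 * m) * H y) {b : ℝ} (hb : 0 < b) (q : ℝ) :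
    ∫⁻ l, ENNReal.ofReal (H l * (b + ‖l‖ ^ 2) ^ (-q)) =
      ENNReal.ofReal (b ^ ((m : ℝ) - q + (Module.finrank ℝ V : ℝ) / 2)) *
        ∫⁻ y, ENNReal.ofReal (H y * (1 + ‖y‖ ^ 2) ^ (-q)) := by
  have hr : 0 < √b := Real.sqrt_pos.2 hb
  have hsq : √b ^ 2 = b := Real.sq_sqrt hb.le
  rw [← lintegral_comp_smul hr]
  have key : ∀ y : V, ENNReal.ofReal (H (√b • y) * (b + ‖√b • y‖ ^ 2) ^ (-q)) =
      ENNReal.ofReal (b ^ ((m : ℝ) - q)) * ENNReal.ofReal (H y * (1 + ‖y‖ ^ 2) ^ (-q)) := by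
    intro y
    rw [← ENNReal.ofReal_mul (by positivity), hhom, pow_mul, hsq, norm_smul, mul_pow,
      Real.norm_eq_abs, sq_abs, hsq, show b + b * ‖y‖ ^ 2 = b * (1 + ‖y‖ ^ 2) by ring,
      Real.mul_rpow hb.le (by positivity), sub_eq_add_neg, Real.rpow_add hb, Real.rpow_natCast]
    congr 1
    ring
  have hpow : √b ^ Module.finrank ℝ V = b ^ ((Module.finrank ℝ V : ℝ) / 2) := by
    rw [Real.sqrt_eq_rpow, ← Real.rpow_natCast, ← Real.rpow_mul hb.le]
    congr 1
    ring
  simp only [key]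
  rw [lintegral_const_mul' _ _ ENNReal.ofReal_ne_top, ← mul_assoc,
    ← ENNReal.ofReal_mul (by positivity), Real.rpow_add hb, hpow, mul_comm (b ^ (_ / _))]

/-- Since ‖y‖^(2m) ≤ (1 + ‖y‖²)^m, the integrand is at most (1 + ‖y‖²)^(m-q), integrable when 2(q -
m) exceeds the dimension. -/
theorem lintegral_norm_pow_mul_rpow_ne_top {m : ℕ} {q : ℝ}
    (h : (m : ℝ) + (Module.finrank ℝ V : ℝ) / 2 < q) :
    ∫⁻ y : V, ENNReal.ofReal (‖y‖ ^ (2 * m) * (1 + ‖y‖ ^ 2) ^ (-q)) ≠ ⊤ := by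
  have hi := integrable_rpow_neg_one_add_norm_sq (E := V) (μ := volume)
    (r := 2 * (q - m)) (by linarith)
  refine ((lintegral_mono fun y => ENNReal.ofReal_le_ofReal ?_).trans_lt hi.lintegral_lt_top).ne
  have h1 : 0 < 1 + ‖y‖ ^ 2 := by positivity
  rw [show -(2 * (q - m)) / 2 = (m : ℝ) + -q by ring, Real.rpow_add h1, Real.rpow_natCast, pow_mul]
  gcongr
  linarith

/-- The integrand is positive off the hyperplane orthogonal to v. The value may be infinite; being
nonzero suffices to transmit divergence of the ω-integral. -/
theorem lintegral_inner_pow_mul_rpow_ne_zero {v : V} (hv : v ≠ 0) (m : ℕ) (q : ℝ) :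
    ∫⁻ y : V, ENNReal.ofReal ((inner ℝ v y) ^ (2 * m) * (1 + ‖y‖ ^ 2) ^ (-q)) ≠ 0 := by
  have hopen : IsOpen {y : V | inner ℝ v y ≠ 0} :=
    isOpen_ne_fun (by fun_prop) continuous_const
  refine ((lintegral_pos_iff_support ?_).2 ?_).ne'
  · have : Measurable fun y : V => inner ℝ v y := by fun_prop
    fun_prop
  · refine (hopen.measure_pos volume ⟨v, by simpa using hv⟩).trans_le (measure_mono fun y hy => ?_)
    have h0 : (inner ℝ v y) ≠ 0 := hy
    have h1 : 0 < (inner ℝ v y) ^ (2 * m) := by rw [pow_mul]; positivity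
    rw [Function.mem_support, ne_eq, ENNReal.ofReal_eq_zero, not_le]
    positivity

end Scaling

/-! ### Integrating out the spatial frequency. -/

section Spectral

variable {d : ℕ} {ν α φ : ℝ} {f : ℝ → ℝ}

/-- The measure on the frequency space with density `g`. -/
noncomputable def spectralMeasure (d : ℕ) (ν α φ : ℝ) (f : ℝ → ℝ) : Measure (SpaceTime d) :=
  volume.withDensity fun ξ => ENNReal.ofReal (spectralDensity d ν α φ f ξ.1 ξ.2)

/-- The power `y ^ p`, set to be `0` at `y = 0` for every exponent. -/
noncomputable def zeroRpow (p y : ℝ) : ℝ := if y = 0 then 0 else y ^ p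

theorem zeroRpow_nonneg {y : ℝ} (hy : 0 ≤ y) (p : ℝ) : 0 ≤ zeroRpow p y := by
  unfold zeroRpow
  split_ifs <;> positivity

@[fun_prop]
theorem measurable_zeroRpow (p : ℝ) : Measurable (zeroRpow p) :=
  Measurable.ite (measurableSet_singleton 0) measurable_const (by fun_prop)

theorem spectralDensity_nonneg (hφ : 0 < φ) (hf : ∀ ω, 0 ≤ f ω)
    (l : EuclideanSpace ℝ (Fin d)) (ω : ℝ) : 0 ≤ spectralDensity d ν α φ f l ω := by
  have := hf ω
  unfold spectralDensity
  split_ifs <;> positivity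

theorem aemeasurable_spectralDensity (hf : AEMeasurable f volume) :
    AEMeasurable (fun ξ : SpaceTime d => spectralDensity d ν α φ f ξ.1 ξ.2) volume := by
  have hG : Measurable fun z : EuclideanSpace ℝ (Fin d) × ℝ =>
      if z.2 = 0 then 0
      else φ * (α ^ 2 * z.2 ^ (-1 / (ν + 1 / 2)) + ‖z.1‖ ^ 2) ^ (-(ν + ((d : ℝ) + 1) / 2)) :=
    Measurable.ite (measurable_snd (measurableSet_singleton 0)) measurable_const (by fun_prop)
  have hm : AEMeasurable (fun ξ : SpaceTime d => (ξ.1, f ξ.2)) volume := by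
    rw [Measure.volume_eq_prod]
    exact measurable_fst.aemeasurable.prodMk hf.comp_snd
  exact hG.comp_aemeasurable hm

theorem lintegral_homogeneous_mul_spectralDensity (hν : -1 / 2 < ν) (hα : 0 < α) (hφ : 0 < φ)
    (hf : ∀ ω, 0 ≤ f ω) {H : EuclideanSpace ℝ (Fin d) → ℝ} {m : ℕ}
    (hhom : ∀ r : ℝ, ∀ y, H (r • y) = r ^ (2 * m) * H y) (ω : ℝ) :
    ∫⁻ l, ENNReal.ofReal (H l * spectralDensity d ν α φ f l ω) =
      ENNReal.ofReal (φ * (α ^ 2) ^ ((m : ℝ) - (ν + 1 / 2))) *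
        (∫⁻ y, ENNReal.ofReal (H y * (1 + ‖y‖ ^ 2) ^ (-(ν + ((d : ℝ) + 1) / 2)))) *
        ENNReal.ofReal (zeroRpow (1 - m / (ν + 1 / 2)) (f ω)) := by
  rcases eq_or_ne (f ω) 0 with h0 | h0
  · simp [spectralDensity, zeroRpow, h0]
  have hpos : 0 < f ω := lt_of_le_of_ne (hf ω) h0.symm
  have hs : 0 < ν + 1 / 2 := by linarith
  have hexp : -1 / (ν + 1 / 2) * ((m : ℝ) - (ν + 1 / 2)) = 1 - m / (ν + 1 / 2) := by
    generalize ν + 1 / 2 = s at hs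
    field_simp
    ring
  simp only [spectralDensity, zeroRpow, h0, if_false]
  have e : ∀ l : EuclideanSpace ℝ (Fin d), ENNReal.ofReal (H l * (φ *
      (α ^ 2 * f ω ^ (-1 / (ν + 1 / 2)) + ‖l‖ ^ 2) ^ (-(ν + ((d : ℝ) + 1) / 2)))) =
      ENNReal.ofReal φ * ENNReal.ofReal (H l *
      (α ^ 2 * f ω ^ (-1 / (ν + 1 / 2)) + ‖l‖ ^ 2) ^ (-(ν + ((d : ℝ) + 1) / 2))) := fun l => by
    rw [← ENNReal.ofReal_mul hφ.le]
    congr 1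
    ring
  simp only [e]
  rw [lintegral_const_mul' _ _ ENNReal.ofReal_ne_top,
    lintegral_homogeneous_mul_rpow hhom (by positivity), finrank_euclideanSpace_fin,
    -- The Jacobian d/2 cancels the dimension in the exponent of g, which is why d is absent from
    -- the criteria.
    show (m : ℝ) - (ν + ((d : ℝ) + 1) / 2) + d / 2 = m - (ν + 1 / 2) by ring,
    Real.mul_rpow (by positivity) (by positivity), ← Real.rpow_mul (hf ω),
    hexp, ENNReal.ofReal_mul (by positivity), ENNReal.ofReal_mul hφ.le]
  ring

/-- Tonelli followed by scaling at each fixed ω. The choices H = 1, ‖λ‖^(2j), ⟨v, λ⟩^(2j) and T = 1,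
ω^(2j) produce every moment needed. -/
theorem lintegral_spectralMeasure (hν : -1 / 2 < ν) (hα : 0 < α) (hφ : 0 < φ)
    (hf : ∀ ω, 0 ≤ f ω) (hfm : AEMeasurable f volume) {H : EuclideanSpace ℝ (Fin d) → ℝ}
    (hH : Measurable H) (hH0 : ∀ l, 0 ≤ H l) {m : ℕ}
    (hhom : ∀ r : ℝ, ∀ y, H (r • y) = r ^ (2 * m) * H y) {T : ℝ → ENNReal} (hT : Measurable T) :
    ∫⁻ ξ, ENNReal.ofReal (H ξ.1) * T ξ.2 ∂(spectralMeasure d ν α φ f) =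
      ENNReal.ofReal (φ * (α ^ 2) ^ ((m : ℝ) - (ν + 1 / 2))) *
        (∫⁻ y, ENNReal.ofReal (H y * (1 + ‖y‖ ^ 2) ^ (-(ν + ((d : ℝ) + 1) / 2)))) *
        ∫⁻ ω, T ω * ENNReal.ofReal (zeroRpow (1 - m / (ν + 1 / 2)) (f ω)) := by
  have hg := (aemeasurable_spectralDensity (d := d) (ν := ν) (α := α) (φ := φ) hfm).ennreal_ofReal
  have hHT : Measurable fun ξ : SpaceTime d => ENNReal.ofReal (H ξ.1) * T ξ.2 := by fun_prop
  rw [spectralMeasure, lintegral_withDensity_eq_lintegral_mul₀ hg hHT.aemeasurable]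
  have hm := hg.mul hHT.aemeasurable
  rw [Measure.volume_eq_prod] at hm ⊢
  rw [lintegral_prod_symm _ hm]
  have hz : AEMeasurable (fun ω => T ω * ENNReal.ofReal (zeroRpow (1 - m / (ν + 1 / 2)) (f ω))) :=
    hT.aemeasurable.mul ((measurable_zeroRpow _).comp_aemeasurable hfm).ennreal_ofReal
  rw [← lintegral_const_mul'' _ hz]
  refine lintegral_congr fun ω => ?_
  rw [mul_left_comm, ← lintegral_homogeneous_mul_spectralDensity hν hα hφ hf hhom ω,
    ← lintegral_const_mul'']
  · refine lintegral_congr fun l => ?_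
    simp only [Pi.mul_apply]
    rw [ENNReal.ofReal_mul (hH0 l)]
    ring
  · refine (Measurable.mul hH ?_).ennreal_ofReal.aemeasurable
    unfold spectralDensity
    split_ifs <;> fun_prop

end Spectral

end HalfSpectral

namespace HalfSpectral

/-! ### Integrability of powers of f from its tail. -/

section Tail

variable {k c : ℝ} {f : ℝ → ℝ}

theorem integrable_of_isBigO_rpow_abs {h : ℝ → ℝ} (hloc : LocallyIntegrable h volume) {r : ℝ}
    (hr : 1 < r) (hO : h =O[cocompact ℝ] fun ω => |ω| ^ (-r)) : Integrable h volume := by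
  refine hloc.integrable_of_isBigO_cocompact (g := fun ω : ℝ => (1 + ‖ω‖) ^ (-r)) (hO.trans ?_)
    ((integrable_one_add_norm (by simpa using hr)).integrableAtFilter _)
  -- For |ω| ≥ 1 one has 1 + |ω| ≤ 2|ω|, whence the constant.
  refine IsBigO.of_bound (2 ^ r) ?_
  filter_upwards [tendsto_norm_cocompact_atTop.eventually_ge_atTop (1 : ℝ)] with ω hω
  rw [Real.norm_eq_abs] at hω
  rw [Real.norm_of_nonneg (by positivity), Real.norm_of_nonneg (by positivity), Real.norm_eq_abs,
    Real.rpow_neg (by positivity), Real.rpow_neg (by positivity), ← div_eq_mul_inv,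
    ← Real.div_rpow (by positivity) (by positivity), ← Real.inv_rpow (by positivity)]
  refine Real.rpow_le_rpow (by positivity) ?_ (by linarith)
  rw [inv_le_iff_one_le_mul₀ (by linarith), div_mul_eq_mul_div, le_div_iff₀ (by linarith)]
  linarith

theorem isBigO_rpow_abs (hf : f ~[cocompact ℝ] fun ω => c * |ω| ^ (-k)) :
    f =O[cocompact ℝ] fun ω => |ω| ^ (-k) :=
  hf.isBigO.trans (isBigO_const_mul_self _ _ _)

theorem integrable_pow_mul (hf_int : Integrable f volume)
    (hf : f ~[cocompact ℝ] fun ω => c * |ω| ^ (-k)) {j : ℕ} (hj : (j : ℝ) < (k - 1) / 2) :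
    Integrable (fun ω => ω ^ (2 * j) * f ω) volume := by
  refine integrable_of_isBigO_rpow_abs (r := k - 2 * j) ?_ (by linarith) ?_
  · exact hf_int.locallyIntegrable.continuous_mul (g := fun ω : ℝ => ω ^ (2 * j)) (by fun_prop)
  · refine ((isBigO_refl (fun ω : ℝ => ω ^ (2 * j)) _).mul
      (isBigO_rpow_abs hf)).trans_eventuallyEq ?_
    filter_upwards [tendsto_norm_cocompact_atTop.eventually_gt_atTop (0 : ℝ)] with ω hω
    rw [Real.norm_eq_abs] at hω
    rw [show -(k - 2 * (j : ℝ)) = ((2 * j : ℕ) : ℝ) + -k by push_cast; ring,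
      Real.rpow_add hω, Real.rpow_natCast, pow_mul, pow_mul, sq_abs]

theorem integrable_rpow (hf_nonneg : ∀ ω, 0 ≤ f ω) (hf_int : Integrable f volume)
    (hf : f ~[cocompact ℝ] fun ω => c * |ω| ^ (-k)) {p : ℝ} (hp : 0 < p) (hp1 : p ≤ 1)
    (hkp : 1 < k * p) : Integrable (fun ω => f ω ^ p) volume := by
  refine integrable_of_isBigO_rpow_abs (r := k * p) ?_ hkp ?_
  · refine LocallyIntegrable.mono (f := fun ω => 1 + f ω)
      ((locallyIntegrable_const (1 : ℝ)).add hf_int.locallyIntegrable)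
      -- Locally f^p ≤ 1 + f because 0 < p ≤ 1.
      (hf_int.1.aemeasurable.pow_const p).aestronglyMeasurable (Eventually.of_forall fun ω => ?_)
    have h0 := hf_nonneg ω
    rw [Real.norm_of_nonneg (by positivity), Real.norm_of_nonneg (by positivity)]
    rcases le_total (f ω) 1 with h | h
    · linarith [Real.rpow_le_one h0 h hp.le]
    · have := Real.rpow_le_rpow_of_exponent_le h hp1
      rw [Real.rpow_one] at this
      linarith
  · refine (isBigO_rpow_abs hf).rpow hp.le ?_ |>.trans_eventuallyEq ?_
    · exact Eventually.of_forall fun ω => by simp only [Pi.zero_apply]; positivity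
    · exact Eventually.of_forall fun ω => by
        simp only
        rw [← Real.rpow_mul (abs_nonneg _)]
        congr 1
        ring

/-- The tail at +∞ decides: there f is nonzero and ω^(-kp) is dominated by f^p. The sign of p is
free, since asymptotic equivalence survives any real power. -/
theorem one_lt_mul_of_lintegral_zeroRpow_ne_top (hf_nonneg : ∀ ω, 0 ≤ f ω)
    (hfm : AEMeasurable f volume) (hc : 0 < c) (hf : f ~[cocompact ℝ] fun ω => c * |ω| ^ (-k))
    {p : ℝ} (h : ∫⁻ ω, ENNReal.ofReal (zeroRpow p (f ω)) ≠ ⊤) : 1 < k * p := by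
  have hint : Integrable (fun ω => zeroRpow p (f ω)) volume :=
    ⟨((measurable_zeroRpow p).comp_aemeasurable hfm).aestronglyMeasurable,
      (hasFiniteIntegral_iff_ofReal (Eventually.of_forall fun ω =>
        zeroRpow_nonneg (hf_nonneg ω) p)).2 h.lt_top⟩
  have hf' : f ~[atTop] fun ω => c * |ω| ^ (-k) := hf.mono atTop_le_cocompact
  have hpow := (hf'.rpow (r := p) fun ω => by
    simp only [Pi.zero_apply]; positivity).isBigO_symm
  have hne : ∀ᶠ ω in atTop, f ω ≠ 0 := by
    have h1 := hf'.isBigO_symm.eq_zero_imp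
    filter_upwards [h1, eventually_gt_atTop 0] with ω h1 h2 h3
    have : 0 < c * |ω| ^ (-k) := mul_pos hc (Real.rpow_pos_of_pos (abs_pos.2 h2.ne') _)
    exact this.ne' (h1 h3)
  have hO : (fun ω : ℝ => ω ^ (-(k * p))) =O[atTop] fun ω => zeroRpow p (f ω) := by
    have h1 : (f ^ p) =ᶠ[atTop] fun ω => zeroRpow p (f ω) := by
      filter_upwards [hne] with ω hω
      simp [zeroRpow, hω]
    have h2 : ((fun ω => c * |ω| ^ (-k)) ^ p) =ᶠ[atTop] fun ω => c ^ p * ω ^ (-(k * p)) := by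
      filter_upwards [eventually_gt_atTop 0] with ω hω
      simp only [Pi.pow_apply]
      rw [Real.mul_rpow hc.le (by positivity), abs_of_pos hω, ← Real.rpow_mul hω.le, neg_mul]
    exact (isBigO_self_const_mul (Real.rpow_pos_of_pos hc p).ne' _ _).trans
      (h2.symm.trans_isBigO (hpow.trans_eventuallyEq h1))
  have hmeas : Measurable fun ω : ℝ => ω ^ (-(k * p)) := by fun_prop
  have := hO.integrableAtFilter (μ := volume) hmeas.stronglyMeasurable.stronglyMeasurableAtFilter
    (hint.integrableAtFilter _)
  linarith [integrableAtFilter_rpow_atTop_iff.1 this]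

end Tail

/-! ### The covariance as a cosine transform. -/

section Covariance

variable {d : ℕ} {ν α φ : ℝ} {f : ℝ → ℝ}

/-- The phase `(s, t), (λ, ω) ↦ sᵀ λ + t ω`. -/
noncomputable def phase (d : ℕ) : SpaceTime d →ₗ[ℝ] SpaceTime d → ℝ where
  toFun p ξ := inner ℝ p.1 ξ.1 + p.2 * ξ.2
  map_add' p q := by
    ext ξ
    simp only [Prod.fst_add, Prod.snd_add, inner_add_left, Pi.add_apply]
    ring
  map_smul' r p := by
    ext ξ
    simp only [Prod.smul_fst, Prod.smul_snd, inner_smul_left, Pi.smul_apply, smul_eq_mul,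
      conj_trivial, RingHom.id_apply]
    ring

theorem phase_apply (p ξ : SpaceTime d) : phase d p ξ = inner ℝ p.1 ξ.1 + p.2 * ξ.2 := rfl

theorem measurable_phase (p : SpaceTime d) : Measurable (phase d p) := by
  have : Measurable fun ξ : SpaceTime d => inner ℝ p.1 ξ.1 + p.2 * ξ.2 := by fun_prop
  exact this

theorem isFiniteMeasure_spectralMeasure (hν : -1 / 2 < ν) (hα : 0 < α) (hφ : 0 < φ)
    (hf : ∀ ω, 0 ≤ f ω) (hf_int : Integrable f volume) :
    IsFiniteMeasure (spectralMeasure d ν α φ f) := by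
  refine ⟨?_⟩
  have h := lintegral_spectralMeasure (d := d) hν hα hφ hf hf_int.1.aemeasurable (H := fun _ => 1)
    (m := 0) (T := fun _ => 1) measurable_const (by simp) (by simp) measurable_const
  simp only [ENNReal.ofReal_one, one_mul, lintegral_one] at h
  rw [h]
  refine ENNReal.mul_lt_top (ENNReal.mul_lt_top ENNReal.ofReal_lt_top ?_) ?_
  · have := lintegral_norm_pow_mul_rpow_ne_top (V := EuclideanSpace ℝ (Fin d)) (m := 0)
      (q := ν + ((d : ℝ) + 1) / 2) (by rw [finrank_euclideanSpace_fin]; push_cast; linarith)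
    simpa [lt_top_iff_ne_top] using this
  · refine lt_of_le_of_lt (lintegral_mono fun ω => ?_) hf_int.lintegral_lt_top
    refine ENNReal.ofReal_le_ofReal ?_
    have := hf ω
    simp only [zeroRpow]
    split_ifs <;> simp_all

/-- Fubini and the real part of the exponential. Covariances are real, so the real part carries all
that is needed. -/
theorem re_covK (hν : -1 / 2 < ν) (hα : 0 < α) (hφ : 0 < φ)
    (hf : ∀ ω, 0 ≤ f ω) (hf_int : Integrable f volume) (p : SpaceTime d) :
    (covK d ν α φ f p).re = ∫ ξ, Real.cos (phase d p ξ) ∂(spectralMeasure d ν α φ f) := by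
  have hfin := isFiniteMeasure_spectralMeasure (d := d) hν hα hφ hf hf_int
  have hgm := aemeasurable_spectralDensity (d := d) (ν := ν) (α := α) (φ := φ)
    hf_int.1.aemeasurable
  have hgi : Integrable (fun ξ : SpaceTime d => spectralDensity d ν α φ f ξ.1 ξ.2) volume := by
    refine ⟨hgm.aestronglyMeasurable, ?_⟩
    rw [hasFiniteIntegral_iff_ofReal
      (Eventually.of_forall fun ξ : SpaceTime d => spectralDensity_nonneg hφ hf ξ.1 ξ.2)]
    have := hfin.measure_univ_lt_top
    rwa [spectralMeasure, withDensity_apply _ MeasurableSet.univ, Measure.restrict_univ] at this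
  have hexp : ∀ ξ : SpaceTime d, Complex.I * ((inner ℝ p.1 ξ.1 : ℝ) : ℂ) +
      Complex.I * ((p.2 * ξ.2 : ℝ) : ℂ) = (phase d p ξ : ℝ) * Complex.I := fun ξ => by
    rw [phase_apply]
    push_cast
    ring
  have hFi : Integrable (fun ξ : SpaceTime d => (spectralDensity d ν α φ f ξ.1 ξ.2 : ℂ) *
      Complex.exp (Complex.I * ((inner ℝ p.1 ξ.1 : ℝ) : ℂ) + Complex.I * ((p.2 * ξ.2 : ℝ) : ℂ)))
      volume := by
    refine hgi.ofReal.mul_bdd (c := 1) ?_ (Eventually.of_forall fun ξ => ?_)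
    · exact Measurable.aestronglyMeasurable (by fun_prop)
    · rw [hexp, Complex.norm_exp_ofReal_mul_I]
  have hprod : covK d ν α φ f p = ∫ ξ : SpaceTime d, (spectralDensity d ν α φ f ξ.1 ξ.2 : ℂ) *
      Complex.exp (Complex.I * ((inner ℝ p.1 ξ.1 : ℝ) : ℂ) +
        Complex.I * ((p.2 * ξ.2 : ℝ) : ℂ)) := by
    rw [Measure.volume_eq_prod] at hFi ⊢
    rw [integral_prod_symm _ hFi, covK]
  have hre := integral_re hFi
  simp only [RCLike.re_to_complex] at hre
  rw [hprod, ← hre, spectralMeasure, integral_withDensity_eq_integral_toReal_smul₀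
    hgm.ennreal_ofReal (Eventually.of_forall fun _ => ENNReal.ofReal_lt_top)]
  refine integral_congr_ae (Eventually.of_forall fun ξ => ?_)
  simp only
  rw [hexp, Complex.re_ofReal_mul, Complex.exp_ofReal_mul_I_re,
    ENNReal.toReal_ofReal (spectralDensity_nonneg hφ hf ξ.1 ξ.2), smul_eq_mul]

end Covariance

end HalfSpectral

namespace HalfSpectral

/-! ### Finiteness of time and space moments. -/

section Moments

variable {d : ℕ} {ν α φ k c : ℝ} {f : ℝ → ℝ}

theorem lintegral_time_pow_ne_top (hν : -1 / 2 < ν) (hα : 0 < α) (hφ : 0 < φ)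
    (hf_nonneg : ∀ ω, 0 ≤ f ω) (hf_int : Integrable f volume)
    (hf : f ~[cocompact ℝ] fun ω => c * |ω| ^ (-k)) {j : ℕ} (hj : (j : ℝ) < (k - 1) / 2) :
    ∫⁻ ξ, ENNReal.ofReal (ξ.2 ^ 2) ^ j ∂(spectralMeasure d ν α φ f) ≠ ⊤ := by
  have h := lintegral_spectralMeasure (d := d) hν hα hφ hf_nonneg hf_int.1.aemeasurable
    (H := fun _ => 1) (m := 0) (T := fun ω => ENNReal.ofReal (ω ^ 2) ^ j) measurable_const
    (by simp) (by simp) (by fun_prop)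
  simp only [ENNReal.ofReal_one, one_mul] at h
  rw [h]
  refine (ENNReal.mul_lt_top (ENNReal.mul_lt_top ENNReal.ofReal_lt_top ?_) ?_).ne
  · have := lintegral_norm_pow_mul_rpow_ne_top (V := EuclideanSpace ℝ (Fin d)) (m := 0)
      (q := ν + ((d : ℝ) + 1) / 2) (by rw [finrank_euclideanSpace_fin]; push_cast; linarith)
    simpa [lt_top_iff_ne_top] using this
  · refine lt_of_le_of_lt (lintegral_mono fun ω => ?_)
      (integrable_pow_mul hf_int hf hj).lintegral_lt_top
    have h0 := hf_nonneg ω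
    rw [← ENNReal.ofReal_pow (sq_nonneg _), ← ENNReal.ofReal_mul (by positivity), ← pow_mul]
    refine ENNReal.ofReal_le_ofReal ?_
    simp only [zeroRpow]
    split_ifs <;> simp_all

theorem lintegral_space_pow_ne_top (hν : -1 / 2 < ν) (hα : 0 < α) (hφ : 0 < φ) (hk : 1 < k)
    (hf_nonneg : ∀ ω, 0 ≤ f ω) (hf_int : Integrable f volume)
    (hf : f ~[cocompact ℝ] fun ω => c * |ω| ^ (-k)) {j : ℕ}
    (hj : (j : ℝ) < (ν + 1 / 2) * ((k - 1) / k)) :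
    ∫⁻ ξ, ENNReal.ofReal (‖ξ.1‖ ^ 2) ^ j ∂(spectralMeasure d ν α φ f) ≠ ⊤ := by
  have hs : 0 < ν + 1 / 2 := by linarith
  have hk0 : 0 < k := by linarith
  have hj' : (j : ℝ) / (ν + 1 / 2) < 1 - 1 / k := by
    rw [div_lt_iff₀ hs, mul_comm]
    rwa [sub_div, div_self hk0.ne'] at hj
  have hkinv : 0 < 1 / k := by positivity
  have h := lintegral_spectralMeasure (d := d) hν hα hφ hf_nonneg hf_int.1.aemeasurable
    (H := fun l => ‖l‖ ^ (2 * j)) (m := j) (T := fun _ => 1) (by fun_prop)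
    (fun l => by positivity)
    (fun r y => by rw [norm_smul, mul_pow, pow_mul ‖r‖, Real.norm_eq_abs, sq_abs, ← pow_mul])
    measurable_const
  simp only [one_mul, mul_one] at h
  simp only [← ENNReal.ofReal_pow (sq_nonneg _), ← pow_mul]
  rw [h]
  refine (ENNReal.mul_lt_top (ENNReal.mul_lt_top ENNReal.ofReal_lt_top ?_) ?_).ne
  · refine (lintegral_norm_pow_mul_rpow_ne_top ?_).lt_top
    rw [finrank_euclideanSpace_fin]
    -- Convergence in λ asks only j < ν + 1/2, weaker than the hypothesis because (k - 1)/k < 1.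
    have : (j : ℝ) < ν + 1 / 2 := by
      rw [← div_lt_one hs]
      linarith
    linarith
  · have hp : 0 < 1 - (j : ℝ) / (ν + 1 / 2) := by linarith
    have hkp : 1 < k * (1 - (j : ℝ) / (ν + 1 / 2)) := by
      rw [← div_lt_iff₀' hk0]
      linarith
    have hi := integrable_rpow hf_nonneg hf_int hf hp
      (sub_le_self _ (by positivity)) hkp
    refine lt_of_le_of_lt (lintegral_mono fun ω => ENNReal.ofReal_le_ofReal ?_)
      hi.lintegral_lt_top
    have h0 := hf_nonneg ω
    simp only [zeroRpow]
    split_ifs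
    · positivity
    · exact le_rfl

theorem lt_of_lintegral_inner_pow_ne_top (hν : -1 / 2 < ν) (hα : 0 < α) (hφ : 0 < φ) (hk : 1 < k)
    (hc : 0 < c) (hf_nonneg : ∀ ω, 0 ≤ f ω) (hf_int : Integrable f volume)
    (hf : f ~[cocompact ℝ] fun ω => c * |ω| ^ (-k)) {j : ℕ} {v : EuclideanSpace ℝ (Fin d)}
    (hv : v ≠ 0)
    (h : ∫⁻ ξ, ENNReal.ofReal (inner ℝ v ξ.1 ^ 2) ^ j ∂(spectralMeasure d ν α φ f) ≠ ⊤) :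
    (j : ℝ) < (ν + 1 / 2) * ((k - 1) / k) := by
  have hs : 0 < ν + 1 / 2 := by linarith
  have hk0 : 0 < k := by linarith
  have e := lintegral_spectralMeasure (d := d) hν hα hφ hf_nonneg hf_int.1.aemeasurable
    (H := fun l => inner ℝ v l ^ (2 * j)) (m := j) (T := fun _ => 1) (by fun_prop)
    (fun l => by rw [pow_mul]; positivity)
    (fun r y => by rw [inner_smul_right, mul_pow]) measurable_const
  simp only [one_mul, mul_one] at e
  simp only [← ENNReal.ofReal_pow (sq_nonneg _), ← pow_mul] at h
  rw [e] at h
  have hcoef : ENNReal.ofReal (φ * (α ^ 2) ^ ((j : ℝ) - (ν + 1 / 2))) ≠ 0 := by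
    rw [ne_eq, ENNReal.ofReal_eq_zero, not_le]
    positivity
  -- The other factors are nonzero, so an infinite ω-integral would make the moment infinite.
  have hkp := one_lt_mul_of_lintegral_zeroRpow_ne_top hf_nonneg hf_int.1.aemeasurable hc hf
    fun htop => h (by
      rw [htop]
      exact ENNReal.mul_top (mul_ne_zero hcoef (lintegral_inner_pow_mul_rpow_ne_zero hv _ _)))
  rw [← div_lt_iff₀' hk0] at hkp
  have : (j : ℝ) / (ν + 1 / 2) < 1 - 1 / k := by linarith
  rw [div_lt_iff₀ hs] at this
  rwa [sub_div, div_self hk0.ne', mul_comm]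

end Moments

/-! ### The constant mean as an atom at frequency zero. -/

section Gaussian

variable {Ω : Type*} [MeasurableSpace Ω] {P : Measure Ω} {d : ℕ} {ν α φ μ : ℝ} {f : ℝ → ℝ}

/-- The spectral measure of the uncentred process: a constant mean `μ` contributes an atom of mass
`μ ^ 2` at the zero frequency. -/
noncomputable def momentMeasure (d : ℕ) (ν α φ μ : ℝ) (f : ℝ → ℝ) : Measure (SpaceTime d) :=
  spectralMeasure d ν α φ f + ENNReal.ofReal (μ ^ 2) • Measure.dirac 0

theorem lintegral_momentMeasure (W : SpaceTime d → ENNReal) :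
    ∫⁻ ξ, W ξ ∂(momentMeasure d ν α φ μ f) =
      ∫⁻ ξ, W ξ ∂(spectralMeasure d ν α φ f) + ENNReal.ofReal (μ ^ 2) * W 0 := by
  rw [momentMeasure, lintegral_add_measure, lintegral_smul_measure, lintegral_dirac, smul_eq_mul]

theorem isFiniteMeasure_momentMeasure (hν : -1 / 2 < ν) (hα : 0 < α) (hφ : 0 < φ)
    (hf_nonneg : ∀ ω, 0 ≤ f ω) (hf_int : Integrable f volume) :
    IsFiniteMeasure (momentMeasure d ν α φ μ f) := by
  have := isFiniteMeasure_spectralMeasure (d := d) hν hα hφ hf_nonneg hf_int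
  refine ⟨?_⟩
  rw [← lintegral_one, lintegral_momentMeasure]
  simp [ENNReal.add_lt_top]

theorem hasSpectralMeasure_of_covariance [IsProbabilityMeasure P] (hν : -1 / 2 < ν) (hα : 0 < α)
    (hφ : 0 < φ) (hf_nonneg : ∀ ω, 0 ≤ f ω) (hf_int : Integrable f volume)
    {Z : SpaceTime d → Ω → ℝ} (hZ : ∀ p, MemLp (Z p) 2 P) (hmean : ∀ p, ∫ w, Z p w ∂P = μ)
    (hcov : ∀ p q, ((cov[Z p, Z q; P] : ℝ) : ℂ) = covK d ν α φ f (p - q)) :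
    HasSpectralMeasure (phase d) (momentMeasure d ν α φ μ f) fun p => (hZ p).toLp (Z p) := by
  intro p q
  have := isFiniteMeasure_spectralMeasure (d := d) hν hα hφ hf_nonneg hf_int
  have hre := congrArg Complex.re (hcov p q)
  rw [Complex.ofReal_re, re_covK hν hα hφ hf_nonneg hf_int, covariance_eq_sub (hZ p) (hZ q),
    hmean, hmean] at hre
  rw [inner_toLp, momentMeasure, integral_add_measure (integrable_cos_phase measurable_phase _),
    integral_smul_measure, integral_dirac, ← hre, ENNReal.toReal_ofReal (sq_nonneg μ)]
  · simp only [Pi.mul_apply, phase_apply]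
    simp
    ring
  · exact (integrable_cos_phase (ρ := Measure.dirac 0) measurable_phase _).smul_measure
      ENNReal.ofReal_ne_top

end Gaussian

end HalfSpectral

/-! ### Assembly of the criteria. -/

theorem mainTheorem5 {Ω : Type*} [MeasurableSpace Ω] (P : Measure Ω)
    (d : ℕ) (hd : 1 ≤ d) (ν α φ k c μ : ℝ)
    (hν : -1 / 2 < ν) (hα : 0 < α) (hφ : 0 < φ) (hk : 1 < k) (hc : 0 < c)
    (f : ℝ → ℝ) (hf_nonneg : ∀ ω, 0 ≤ f ω) (hf_int : Integrable f volume)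
    (hf_asymp : f ~[cocompact ℝ] fun ω => c * |ω| ^ (-k))
    (Z : HalfSpectral.SpaceTime d → Ω → ℝ) (hZ : IsGaussianProcess Z P)
    (hmean : ∀ p, ∫ w, Z p w ∂P = μ)
    (hcov : ∀ p q, ((cov[Z p, Z q; P] : ℝ) : ℂ) = HalfSpectral.covK d ν α φ f (p - q))
    (m : ℕ) :
    -- in time
    ((m : ℝ) < (k - 1) / 2 →
      HalfSpectral.MSDifferentiable P (HalfSpectral.timeDir d) m Z) ∧
    -- in space: all mixed spatial derivatives up to order `m`
    (HalfSpectral.MSDifferentiable P (HalfSpectral.spaceDirs d) m Z ↔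
      (m : ℝ) < (ν + 1 / 2) * ((k - 1) / k)) ∧
    -- in space: along any single spatial direction
    (∀ v : EuclideanSpace ℝ (Fin d), v ≠ 0 →
      (HalfSpectral.MSDifferentiable P {((v, 0) : HalfSpectral.SpaceTime d)} m Z ↔
        (m : ℝ) < (ν + 1 / 2) * ((k - 1) / k))) := by
  open HalfSpectral in
  have hprob : IsProbabilityMeasure P := hZ.isProbabilityMeasure
  have hL2 : ∀ p, MemLp (Z p) 2 P := fun p => (hZ.hasGaussianLaw_eval p).memLp_two
  have hspec := hasSpectralMeasure_of_covariance hν hα hφ hf_nonneg hf_int hL2 hmean hcov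
  have hfin := isFiniteMeasure_momentMeasure (d := d) (μ := μ) hν hα hφ hf_nonneg hf_int
  -- The atom adds μ² W(0), so the mean never affects finiteness.
  have hatom : ∀ (W : SpaceTime d → ENNReal), W 0 ≠ ⊤ →
      ∫⁻ ξ, W ξ ∂(spectralMeasure d ν α φ f) ≠ ⊤ →
      ∫⁻ ξ, W ξ ∂(momentMeasure d ν α φ μ f) ≠ ⊤ := fun W h0 h => by
    rw [lintegral_momentMeasure]
    exact ENNReal.add_ne_top.2 ⟨h, ENNReal.mul_ne_top ENNReal.ofReal_ne_top h0⟩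
  have htime : (m : ℝ) < (k - 1) / 2 → MSDifferentiable P (timeDir d) m Z := fun hm => by
    refine msDifferentiable_of_lintegral_pow_ne_top measurable_phase
      (W := fun ξ => ENNReal.ofReal (ξ.2 ^ 2)) ?_ m (fun j hj => ?_) hL2 hspec
    · rintro u rfl
      exact ⟨1, ENNReal.one_ne_top, fun ξ => by simp [phase_apply]⟩
    · have hjm : (j : ℝ) ≤ m := by exact_mod_cast hj
      exact hatom _ (by finiteness)
        (lintegral_time_pow_ne_top hν hα hφ hf_nonneg hf_int hf_asymp (hjm.trans_lt hm))
  have hspace : (m : ℝ) < (ν + 1 / 2) * ((k - 1) / k) → MSDifferentiable P (spaceDirs d) m Z :=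
    fun hm => by
    refine msDifferentiable_of_lintegral_pow_ne_top measurable_phase
      (W := fun ξ => ENNReal.ofReal (‖ξ.1‖ ^ 2)) ?_ m (fun j hj => ?_) hL2 hspec
    · rintro _ ⟨v, rfl⟩
      -- By Cauchy–Schwarz the single weight ‖λ‖² dominates all spatial directions, hence covers
      -- mixed derivatives.
      refine ⟨ENNReal.ofReal (‖v‖ ^ 2), ENNReal.ofReal_ne_top, fun ξ => ?_⟩
      rw [← ENNReal.ofReal_mul (sq_nonneg _), phase_apply, ← mul_pow]
      refine ENNReal.ofReal_le_ofReal (sq_le_sq.2 ?_)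
      rw [abs_of_nonneg (by positivity : 0 ≤ ‖v‖ * ‖ξ.1‖)]
      simpa using abs_real_inner_le_norm v ξ.1
    · have hjm : (j : ℝ) ≤ m := by exact_mod_cast hj
      exact hatom _ (by finiteness)
        (lintegral_space_pow_ne_top hν hα hφ hk hf_nonneg hf_int hf_asymp (hjm.trans_lt hm))
  have hdir : ∀ v : EuclideanSpace ℝ (Fin d), v ≠ 0 →
      MSDifferentiable P {((v, 0) : SpaceTime d)} m Z → (m : ℝ) < (ν + 1 / 2) * ((k - 1) / k) :=
    fun v hv h => by
    have h1 := h.lintegral_pow_ne_top measurable_phase hL2 hspec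
    rw [lintegral_momentMeasure] at h1
    refine lt_of_lintegral_inner_pow_ne_top hν hα hφ hk hc hf_nonneg hf_int hf_asymp hv ?_
    simpa [phase_apply] using (ENNReal.add_ne_top.1 h1).1
  have hsub : ∀ v : EuclideanSpace ℝ (Fin d), {((v, 0) : SpaceTime d)} ⊆ spaceDirs d :=
    fun v => Set.singleton_subset_iff.2 ⟨v, rfl⟩
  refine ⟨htime, ⟨fun h => ?_, hspace⟩, fun v hv => ⟨hdir v hv, fun h => (hspace h).mono (hsub v)⟩⟩
  -- d ≥ 1 provides a nonzero direction, to which necessity is reduced.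
  have : Nonempty (Fin d) := ⟨⟨0, hd⟩⟩
  obtain ⟨v, hv⟩ := exists_ne (0 : EuclideanSpace ℝ (Fin d))
  exact hdir v hv (h.mono (hsub v))
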